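/- Let $S=\bigoplus_{n\ge 0}S_n$ be a commutative Noetherian $\mathbb N$-graded ring whose degree-$0$ component $S_0$ is local with algebraically closed residue field $\mathbb k$, and let $\mathfrak m=\mathfrak m_0S+\bigoplus_{n>0}S_n$ be its homogeneous maximal ideal, $\mathfrak m_0$ being the maximal ideal of $S_0$. Let $M$ be a finitely generated $\mathbb Z$-graded $S$-module, let $\mathbf F$ be a minimal homogeneous free resolution of $M$ (a resolution $\cdots\to F_1\to F_0\to M$ by graded free modules with degree-$0$ maps and $\partial(F_{i+1})\subseteq\mathfrak m F_i$; it may be infinite), and let $a\in\mathbb Z$. A degree $a$ differential module is a $\mathbb Z$-graded $S$-module $D$ with an $S$-linear map $d:D\to D$ satisfying $d^2=0$ and $d(D_j)\subseteq D_{j+a}$; its homology is $H(D)=\ker d/\operatorname{im} d$ with the grading induced by $\ker d$. A morphism is a degree-preserving $S$-linear map commuting with the differentials; it is a quasi-isomorphism if it induces an isomorphism on homology. Two differential modules are quasi-isomorphic if they are connected by a finite zigzag of quasi-isomorphisms. For a homogeneous complex $(C_\bullet,\partial)$, $\operatorname{Fold}^a(C_\bullet)$ is the degree $a$ differential module $\left(\bigoplus_i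 C_i(ia),\partial\right)$, where $C(n)_j=C_{n+j}$. A degree $a$ free flag is a degree $a$ differential module $D$ with a splitting $D=\bigoplus_{i\ge0}G_i$ into graded free modules with $d(G_i)\subseteq\bigoplus_{j<i}G_j$; it is anchored on $C_\bullet$ if the complex formed by the $G_i$ and the components $G_{i+1}\to G_i$ of $d$ is isomorphic to $C_\bullet$ with each $C_i$ twisted to $C_i(ia)$. The module $M$ is $a$-rigid if, for every homogeneous free resolution $\mathbf G$ of $M$, every degree $a$ free flag anchored on $\mathbf G$ is isomorphic, as a differential module, to $\operatorname{Fold}^a(\mathbf G)$. Finally, $\operatorname{Ext}^i_S(M,M)_j$ denotes the set of classes in $\operatorname{Ext}^i_S(M,M)=H^i(\operatorname{Hom}_S(\mathbf F,M))$ of cocycles $F_i\to M$ that are homogeneous of degree $j$. If $\operatorname{Ext}^i_S(M,M)_{a-ia}=0$ for all integers $i$ with $2\le i\le\operatorname{pdim}_S(M)$ (all $i\ge2$ if $\operatorname{pdim}_S(M)=\infty$), then every degree $a$ differential module $D$ with $H(D)\cong M$ as graded modules is quasi-isomorphic to $\operatorname{Fold}^a(\mathbf F)$, and $M$ is $a$-rigid.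 -/

import Mathlib

open CategoryTheory DirectSum

universe u

namespace DiffMod

section Graded

variable {S : Type u} [CommRing S] (𝒮 : ℕ → AddSubgroup S)

/-- A family of additive subgroups `ℳ j`, `j : ℤ`, makes the `S`-module `M` a graded module over
the `ℕ`-graded ring `S = ⨁ 𝒮 n`: `M` is the internal direct sum of the `ℳ j`, and
`𝒮 n • ℳ j ⊆ ℳ (n + j)`. -/
structure IsGradedModule {M : Type u} [AddCommGroup M] [Module S M]
    (ℳ : ℤ → AddSubgroup M) : Prop where
  isInternal : DirectSum.IsInternal ℳ
  smul_mem : ∀ (n : ℕ) (j : ℤ) (s : S) (x : M), s ∈ 𝒮 n → x ∈ ℳ j → s • x ∈ ℳ ((n : ℤ) + j)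

/-- A graded module is (graded) free if it has a basis consisting of homogeneous elements. -/
def IsGradedFree (S : Type u) [CommRing S] {M : Type u} [AddCommGroup M] [Module S M]
    (ℳ : ℤ → AddSubgroup M) : Prop :=
  ∃ (ι : Type u) (b : Module.Basis ι S M), ∀ i, ∃ j, b i ∈ ℳ j

/-- The homogeneous maximal ideal `𝔪₀ S + S₊` of a graded-local ring: `S` is `ℕ`-graded and `𝔪₀` is
the maximal ideal of the local ring `𝒮 0`. The quotient of `S` by it is the residue field
of `𝒮 0`. -/
def homogeneousMaximalIdeal [GradedRing 𝒮] [IsLocalRing (𝒮 0)] : Ideal S :=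
  (IsLocalRing.maximalIdeal (𝒮 0)).map (algebraMap (𝒮 0) S) ⊔
    (HomogeneousIdeal.irrelevant 𝒮).toIdeal

/-- A homogeneous chain complex `⋯ → X 1 → X 0` of graded `S`-modules, with differentials of
internal degree `0`. -/
structure HomogeneousComplex where
  complex : ChainComplex (ModuleCat.{u} S) ℕ
  grading : ∀ i, ℤ → AddSubgroup (complex.X i)
  isGraded : ∀ i, IsGradedModule 𝒮 (grading i)
  d_mem : ∀ (i k : ℕ) (j : ℤ) (x : complex.X i), x ∈ grading i j →
    (complex.d i k).hom x ∈ grading k j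

/-- A differential module of (internal) degree `a`: a graded `S`-module `D` with an endomorphism `d`
with `d ∘ d = 0` that raises degrees by `a`, that is, a graded map `d : D → D(a)`. -/
structure DM (a : ℤ) where
  carrier : Type u
  [addCommGroup : AddCommGroup carrier]
  [module : Module S carrier]
  grading : ℤ → AddSubgroup carrier
  isGraded : IsGradedModule 𝒮 grading
  d : carrier →ₗ[S] carrier
  d_mem : ∀ (j : ℤ) (x : carrier), x ∈ grading j → d x ∈ grading (j + a)
  d_d : ∀ x, d (d x) = 0

attribute [instance] DM.addCommGroup DM.module

end Graded

section Homology

variable {S : Type u} [CommRing S] {𝒮 : ℕ → AddSubgroup S} {a : ℤ}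

/-- The homology `ker d / im d` of a differential module. -/
abbrev DM.Homology (D : DM 𝒮 a) : Type u :=
  LinearMap.ker D.d ⧸ (LinearMap.range D.d).submoduleOf (LinearMap.ker D.d)

/-- The grading of the homology: the classes of degree `j` are those of the cycles of degree `j`. -/
def DM.homologyGrading (D : DM 𝒮 a) (j : ℤ) : AddSubgroup D.Homology :=
  ((D.grading j).comap (LinearMap.ker D.d).subtype.toAddMonoidHom).map
    ((LinearMap.range D.d).submoduleOf (LinearMap.ker D.d)).mkQ.toAddMonoidHom

/-- `D` has homology `M`: there is a degree-preserving isomorphism of graded modules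
`H(D) ≅ M`. -/
def DM.HasHomology (D : DM 𝒮 a) {M : Type u} [AddCommGroup M] [Module S M]
    (ℳ : ℤ → AddSubgroup M) : Prop :=
  ∃ e : D.Homology ≃ₗ[S] M, ∀ j y, y ∈ D.homologyGrading j ↔ e y ∈ ℳ j

/-- Morphisms of degree `a` differential modules: degree-preserving linear maps commuting with the
differentials. -/
structure DM.Hom (D E : DM 𝒮 a) where
  toLinearMap : D.carrier →ₗ[S] E.carrier
  map_mem : ∀ j x, x ∈ D.grading j → toLinearMap x ∈ E.grading j
  comm : ∀ x, E.d (toLinearMap x) = toLinearMap (D.d x)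

theorem DM.Hom.map_ker {D E : DM 𝒮 a} (f : DM.Hom D E) (x : D.carrier)
    (hx : x ∈ LinearMap.ker D.d) : f.toLinearMap x ∈ LinearMap.ker E.d := by
  rw [LinearMap.mem_ker] at hx ⊢
  rw [f.comm, hx, map_zero]

/-- The map induced on homology by a morphism of differential modules. -/
def DM.Hom.homologyMap {D E : DM 𝒮 a} (f : DM.Hom D E) : D.Homology →ₗ[S] E.Homology :=
  Submodule.mapQ _ _ (f.toLinearMap.restrict f.map_ker) (by
    rintro ⟨x, hx⟩ ⟨y, hy⟩
    exact ⟨f.toLinearMap y, by rw [f.comm, hy]; rfl⟩)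

/-- A quasi-isomorphism is a morphism that induces an isomorphism on homology. -/
def DM.Hom.IsQuasiIso {D E : DM 𝒮 a} (f : DM.Hom D E) : Prop :=
  Function.Bijective f.homologyMap

/-- Two differential modules are quasi-isomorphic if they are connected by a finite zigzag of
quasi-isomorphisms. -/
def DM.QuasiIsomorphic (D E : DM 𝒮 a) : Prop :=
  Relation.EqvGen (fun D E : DM 𝒮 a => ∃ f : DM.Hom D E, f.IsQuasiIso) D E

/-- Two differential modules are isomorphic if there is a degree-preserving linear bijection
commuting with the differentials. -/
def DM.Isomorphic (D E : DM 𝒮 a) : Prop :=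
  ∃ e : D.carrier ≃ₗ[S] E.carrier, (∀ j x, x ∈ D.grading j ↔ e x ∈ E.grading j) ∧
    ∀ x, E.d (e x) = e (D.d x)

end Homology

section Fold

variable {S : Type u} [CommRing S] {𝒮 : ℕ → AddSubgroup S}

/-- The underlying module `⨁ i, X i` of the fold of a complex. -/
abbrev HomogeneousComplex.FoldModule (K : HomogeneousComplex 𝒮) : Type u :=
  ⨁ i, K.complex.X i

/-- The differential of the fold of a complex, given by `X (i + 1) → X i` on the summands. -/
noncomputable def HomogeneousComplex.foldD (K : HomogeneousComplex 𝒮) :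
    K.FoldModule →ₗ[S] K.FoldModule :=
  DirectSum.toModule S ℕ K.FoldModule fun
    | 0 => 0
    | i + 1 => DirectSum.lof S ℕ (fun i => K.complex.X i) i ∘ₗ (K.complex.d (i + 1) i).hom

/-- The degree `j` part of `⨁ i, X i (i a)`: the elements whose `i`-th component has degree
`j + i a` in `X i`, for all `i`. -/
def HomogeneousComplex.foldGrading (K : HomogeneousComplex 𝒮) (a j : ℤ) :
    AddSubgroup K.FoldModule where
  carrier := {x | ∀ i : ℕ, x i ∈ K.grading i (j + i * a)}
  zero_mem' := fun i => (K.grading i _).zero_mem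
  add_mem' := fun hx hy i => (K.grading i _).add_mem (hx i) (hy i)
  neg_mem' := fun hx i => (K.grading i _).neg_mem (hx i)

theorem HomogeneousComplex.foldD_lof_zero (K : HomogeneousComplex 𝒮) (x : K.complex.X 0) :
    K.foldD (DirectSum.lof S ℕ (fun i => K.complex.X i) 0 x) = 0 := by
  simp [HomogeneousComplex.foldD, DirectSum.toModule_lof]

theorem HomogeneousComplex.foldD_lof_succ (K : HomogeneousComplex 𝒮) (i : ℕ)
    (x : K.complex.X (i + 1)) :
    K.foldD (DirectSum.lof S ℕ (fun i => K.complex.X i) (i + 1) x) =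
      DirectSum.lof S ℕ (fun i => K.complex.X i) i ((K.complex.d (i + 1) i).hom x) := by
  simp [HomogeneousComplex.foldD, DirectSum.toModule_lof]

theorem HomogeneousComplex.foldD_apply (K : HomogeneousComplex 𝒮) (x : K.FoldModule) (i : ℕ) :
    K.foldD x i = (K.complex.d (i + 1) i).hom (x (i + 1)) := by
  induction x using DirectSum.induction_on with
  | zero => simp
  | add x y hx hy => simp [hx, hy]
  | of k x =>
    change K.foldD (DirectSum.lof S ℕ (fun i => K.complex.X i) k x) i =
      (K.complex.d (i + 1) i).hom (DirectSum.lof S ℕ (fun i => K.complex.X i) k x (i + 1))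
    cases k with
    | zero =>
      rw [K.foldD_lof_zero, DirectSum.lof_eq_of, DirectSum.of_eq_of_ne _ _ _ (by omega)]
      simp
    | succ k =>
      rw [K.foldD_lof_succ]
      by_cases h : i = k
      · subst h
        simp only [DirectSum.lof_apply]
      · rw [DirectSum.lof_eq_of, DirectSum.lof_eq_of, DirectSum.of_eq_of_ne _ _ _ h,
          DirectSum.of_eq_of_ne _ _ _ (by omega), map_zero]

theorem HomogeneousComplex.foldGrading_isInternal (K : HomogeneousComplex 𝒮) (a : ℤ) :
    DirectSum.IsInternal (K.foldGrading a) := by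
  constructor
  · rw [injective_iff_map_eq_zero]
    intro y hy
    ext j i
    let c : ∀ (i : ℕ) (j : ℤ), K.foldGrading a j →+ K.grading i (j + i * a) := fun i j =>
      { toFun := fun x => ⟨x.1 i, x.2 i⟩
        map_zero' := rfl
        map_add' := fun _ _ => rfl }
    let θ : (⨁ j, K.foldGrading a j) →+ ⨁ m, K.grading i m :=
      DirectSum.toAddMonoid fun j => (DirectSum.of (fun m => K.grading i m) (j + i * a)).comp (c i j)
    have h1 : ∀ y, DirectSum.coeAddMonoidHom (K.grading i) (θ y) =
        DirectSum.coeAddMonoidHom (K.foldGrading a) y i := by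
      intro y
      induction y using DirectSum.induction_on with
      | zero => simp
      | add x y hx hy => simp [hx, hy]
      | of k x =>
        simp [θ, c]
        rfl
    have h2 : ∀ y, ((θ y (j + i * a) : K.grading i (j + i * a)) : K.complex.X i) = (y j).1 i := by
      intro y
      induction y using DirectSum.induction_on with
      | zero => simp
      | add x y hx hy => simp [hx, hy]
      | of k x =>
        simp only [θ, DirectSum.toAddMonoid_of, AddMonoidHom.comp_apply]
        by_cases h : j = k
        · subst h
          simp [c]
          rfl
        · rw [DirectSum.of_eq_of_ne _ _ _ h, DirectSum.of_eq_of_ne _ _ _ (by omega)]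
          simp
    have h3 : θ y = 0 := by
      apply (K.isGraded i).isInternal.1
      rw [h1, hy]
      simp
    rw [← h2, h3]
    simp
  · rw [← AddMonoidHom.mrange_eq_top, eq_top_iff]
    intro x _
    induction x using DirectSum.induction_on with
    | zero => exact zero_mem _
    | add x y hx hy => exact add_mem (hx trivial) (hy trivial)
    | of i z =>
      obtain ⟨w, rfl⟩ := (K.isGraded i).isInternal.2 z
      induction w using DirectSum.induction_on with
      | zero => simp
      | add x y hx hy =>
        rw [map_add, map_add]
        exact add_mem (hx trivial) (hy trivial)
      | of m v =>
        rw [DirectSum.coeAddMonoidHom_of]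
        refine ⟨DirectSum.of (fun j => K.foldGrading a j) (m - i * a)
          ⟨DirectSum.of (fun i => K.complex.X i) i v, fun k => ?_⟩, ?_⟩
        · by_cases h : k = i
          · subst h
            rw [DirectSum.of_eq_same]
            convert v.2 using 1
            ring_nf
          · rw [DirectSum.of_eq_of_ne _ _ _ h]
            exact zero_mem _
        · rw [DirectSum.coeAddMonoidHom_of]

/-- The degree `a` fold of a homogeneous complex `X`: the module `⨁ i, X i (i a)` with the
endomorphism given by the differentials of the complex. -/
noncomputable def HomogeneousComplex.fold (K : HomogeneousComplex 𝒮) (a : ℤ) : DM 𝒮 a where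
  carrier := K.FoldModule
  grading := K.foldGrading a
  isGraded :=
    { isInternal := K.foldGrading_isInternal a
      smul_mem := fun n j s x hs hx i => by
        have h := (K.isGraded i).smul_mem n (j + i * a) s (x i) hs (hx i)
        rw [← add_assoc] at h
        exact h }
  d := K.foldD
  d_mem := fun j x hx i => by
    rw [K.foldD_apply]
    have h := K.d_mem (i + 1) i _ _ (hx (i + 1))
    convert h using 1
    push_cast
    ring_nf
  d_d := fun x => by
    ext i
    rw [K.foldD_apply, K.foldD_apply]
    exact LinearMap.congr_fun
      (congrArg ModuleCat.Hom.hom (K.complex.d_comp_d (i + 1 + 1) (i + 1) i)) _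

end Fold

section Flags

variable {S : Type u} [CommRing S] {𝒮 : ℕ → AddSubgroup S} {a : ℤ}

/-- A free flag structure on a differential module `D` of degree `a`: a splitting `D = ⨁ i, F i`,
`i ≥ 0`, into graded free modules `F i` with `d (F i) ⊆ ⨁ j < i, F j`. -/
structure DM.FreeFlag (D : DM 𝒮 a) where
  piece : ℕ → Submodule S D.carrier
  isInternal : DirectSum.IsInternal piece
  free : ∀ i, IsGradedFree S
    (fun j => (D.grading j).comap (piece i).subtype.toAddMonoidHom)
  d_mem : ∀ i, ∀ x ∈ piece i, D.d x ∈ ⨆ j, ⨆ _ : j < i, piece j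

/-- The free flag `⨁ i, F i` is anchored on the complex `X`: its anchor, the complex of the `F i`
with differentials `F (i + 1) → F i` the components of `d`, is isomorphic to `X` with
`X i` twisted by `i a` (so that all the maps have degree `a`). -/
def DM.FreeFlag.AnchoredOn {D : DM 𝒮 a} (F : D.FreeFlag) (K : HomogeneousComplex 𝒮) : Prop :=
  ∃ φ : ∀ i, K.complex.X i ≃ₗ[S] F.piece i,
    (∀ i j x, x ∈ K.grading i (j + i * a) ↔ (φ i x : D.carrier) ∈ D.grading j) ∧
    ∀ i x, D.d (φ (i + 1) x : D.carrier) - (φ i ((K.complex.d (i + 1) i).hom x) : D.carrier) ∈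
      ⨆ j, ⨆ _ : j < i, F.piece j

/-- A homogeneous complex is `a`-rigid if every free flag of degree `a` anchored on it is
isomorphic to its degree `a` fold. -/
def HomogeneousComplex.IsRigid (K : HomogeneousComplex 𝒮) (a : ℤ) : Prop :=
  ∀ (D : DM 𝒮 a) (F : D.FreeFlag), F.AnchoredOn K → D.Isomorphic (K.fold a)

end Flags

section Resolutions

variable {S : Type u} [CommRing S] (𝒮 : ℕ → AddSubgroup S)
  {M : Type u} [AddCommGroup M] [Module S M] (ℳ : ℤ → AddSubgroup M)

/-- A homogeneous free resolution of a graded module `M`: a resolution of `M` by graded free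
modules, in which all differentials and the augmentation preserve degrees. -/
structure FreeResolution where
  res : ProjectiveResolution (ModuleCat.of S M)
  grading : ∀ i, ℤ → AddSubgroup (res.complex.X i)
  isGraded : ∀ i, IsGradedModule 𝒮 (grading i)
  free : ∀ i, IsGradedFree S (grading i)
  d_mem : ∀ (i k : ℕ) (j : ℤ) (x : res.complex.X i), x ∈ grading i j →
    (res.complex.d i k).hom x ∈ grading k j
  π_mem : ∀ (j : ℤ) (x : res.complex.X 0), x ∈ grading 0 j →
    ((res.π.f 0).hom x : M) ∈ ℳ j

variable {𝒮 ℳ}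

/-- The underlying homogeneous complex of a homogeneous free resolution. -/
def FreeResolution.toComplex (F : FreeResolution 𝒮 ℳ) : HomogeneousComplex 𝒮 where
  complex := F.res.complex
  grading := F.grading
  isGraded := F.isGraded
  d_mem := F.d_mem

/-- A homogeneous free resolution is minimal if `d ⊗ 𝕜 = 0`, that is, if the image of each
differential lies in `𝔪 F i`, where `𝔪` is the homogeneous maximal ideal. -/
def FreeResolution.IsMinimal [GradedRing 𝒮] [IsLocalRing (𝒮 0)] (F : FreeResolution 𝒮 ℳ) : Prop :=
  ∀ (i : ℕ) (x : F.res.complex.X (i + 1)), (F.res.complex.d (i + 1) i).hom x ∈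
    homogeneousMaximalIdeal 𝒮 • (⊤ : Submodule S (F.res.complex.X i))

/-- The internal degree `j` part `Ext^i_S(M, N)_j` of `Ext^i_S(M, N)`, for graded modules `M` and
`N`: the classes in `Ext^i_S(M, N) = H^i(Hom_S(F, N))` of the cocycles `F i → N` that are
homogeneous of degree `j`, where `F` is a homogeneous free resolution of `M`. -/
noncomputable def FreeResolution.extDegree (F : FreeResolution 𝒮 ℳ)
    {N : Type u} [AddCommGroup N] [Module S N] (𝒩 : ℤ → AddSubgroup N) (i : ℕ) (j : ℤ) :
    AddSubgroup (Abelian.Ext (ModuleCat.of S M) (ModuleCat.of S N) i) where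
  carrier := {α | ∃ (f : F.res.complex.X i ⟶ ModuleCat.of S N)
    (hf : F.res.complex.d (i + 1) i ≫ f = 0),
    (∀ m x, x ∈ F.grading i m → (f.hom x : N) ∈ 𝒩 (m + j)) ∧ F.res.extMk f (i + 1) rfl hf = α}
  zero_mem' := ⟨0, by simp, fun m x _ => (𝒩 (m + j)).zero_mem, by simp⟩
  add_mem' := by
    rintro _ _ ⟨f, hf, hf', rfl⟩ ⟨g, hg, hg', rfl⟩
    exact ⟨f + g, by simp [hf, hg], fun m x hx => (𝒩 (m + j)).add_mem (hf' m x hx) (hg' m x hx),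
      (F.res.add_extMk f g _ _ hf hg).symm⟩
  neg_mem' := by
    rintro _ ⟨f, hf, hf', rfl⟩
    exact ⟨-f, by simp [hf], fun m x hx => (𝒩 (m + j)).neg_mem (hf' m x hx),
      (F.res.neg_extMk f _ _ hf).symm⟩

end Resolutions

section Rigid

variable {S : Type u} [CommRing S] (𝒮 : ℕ → AddSubgroup S)
  {M : Type u} [AddCommGroup M] [Module S M] (ℳ : ℤ → AddSubgroup M)

/-- A graded module is `a`-rigid if its homogeneous free resolutions are `a`-rigid. -/
def IsRigidModule (a : ℤ) : Prop :=
  ∀ F : FreeResolution 𝒮 ℳ, F.toComplex.IsRigid a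

end Rigid

end DiffMod

/-! Let `G` be a homogeneous free resolution of `M`. A morphism from its fold to `D` is a family `φ
n : G n → D` of degree `-na` with `d (φ 0) = 0` and `d (φ (n+1)) = φ n ∘ ∂`. Such a family is built
by obstruction theory, starting from a `φ 0` that induces `M ≅ H(D)`. Suppose `φ n ∘ ∂` takes
boundary values. Lift it through `d` to `ψ` on `G (n+1)`. Then `ψ ∘ ∂` is cycle-valued, and its
class in `H(D) ≅ M` is a cocycle on `G (n+2)` of degree `-(n+1)a = a - (n+2)a`. By the Ext
hypothesis it is a coboundary `g ∘ ∂`. Lifting `g` to `γ : G (n+1) → G 0` and replacing `ψ` by `ψ -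
φ 0 ∘ γ` keeps `d ψ` and makes `ψ ∘ ∂` boundary-valued (`exists_next`, iterated in
`exists_fold_map`). The resulting morphism is a quasi-isomorphism, since homology of the fold is
detected in the summand `G 0` (`isQuasiIso_of_zero`).

For rigidity, `D` is a flag anchored on `G`, and the same construction is run with `φ n` kept
congruent to the inclusion `G n → D` modulo the earlier pieces. Exactness of `G` makes this possible
(`exists_homologous`, `exists_d_eq`), and a map that is triangular in this sense is bijective
(`bijective_of_sub_incl_mem`). A degree-preserving comparison of resolutions carries the Ext
hypothesis from `F` to every `G` (`exists_homogeneous_coboundary`). -/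

namespace DiffMod

/-! ### Projections onto homogeneous components -/

section Projections

variable {A : Type*} [AddCommGroup A] {𝒜 : ℤ → AddSubgroup A}

/-- The projection of a graded group onto its component of degree `j`. -/
noncomputable def proj (h : DirectSum.IsInternal 𝒜) (j : ℤ) : A →+ A :=
  ((𝒜 j).subtype.comp (DFinsupp.evalAddMonoidHom j)).comp
    (AddEquiv.ofBijective (DirectSum.coeAddMonoidHom 𝒜) h).symm.toAddMonoidHom

theorem proj_mem (h : DirectSum.IsInternal 𝒜) (j : ℤ) (x : A) : proj h j x ∈ 𝒜 j :=
  SetLike.coe_mem _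

theorem symm_of_mem (h : DirectSum.IsInternal 𝒜) {j : ℤ} {x : A} (hx : x ∈ 𝒜 j) :
    (AddEquiv.ofBijective (DirectSum.coeAddMonoidHom 𝒜) h).symm x =
      DirectSum.of (fun j => 𝒜 j) j ⟨x, hx⟩ := by
  rw [AddEquiv.symm_apply_eq]
  exact (DirectSum.coeAddMonoidHom_of 𝒜 j ⟨x, hx⟩).symm

theorem proj_of_mem (h : DirectSum.IsInternal 𝒜) {j : ℤ} {x : A} (hx : x ∈ 𝒜 j) :
    proj h j x = x := by
  change (((AddEquiv.ofBijective (DirectSum.coeAddMonoidHom 𝒜) h).symm x j : 𝒜 j) : A) = x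
  rw [symm_of_mem h hx, DirectSum.of_eq_same]

theorem proj_of_mem_ne (h : DirectSum.IsInternal 𝒜) {i j : ℤ} {x : A} (hx : x ∈ 𝒜 i)
    (hij : j ≠ i) : proj h j x = 0 := by
  change (((AddEquiv.ofBijective (DirectSum.coeAddMonoidHom 𝒜) h).symm x j : 𝒜 j) : A) = 0
  rw [symm_of_mem h hx, DirectSum.of_eq_of_ne _ _ _ hij, ZeroMemClass.coe_zero]

theorem graded_induction (h : DirectSum.IsInternal 𝒜) {p : A → Prop} (zero : p 0)
    (add : ∀ x y, p x → p y → p (x + y)) (mem : ∀ j, ∀ x ∈ 𝒜 j, p x) (x : A) : p x := by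
  obtain ⟨w, rfl⟩ := h.2 x
  induction w using DirectSum.induction_on with
  | zero => simpa using zero
  | add x y hx hy => rw [map_add]; exact add _ _ hx hy
  | of j v => rw [DirectSum.coeAddMonoidHom_of]; exact mem j _ v.2

/-- Both sides are additive, so homogeneous `x` suffice. This is the tool that turns arbitrary
choices below into homogeneous ones. -/
theorem map_proj {B : Type*} [AddCommGroup B] {ℬ : ℤ → AddSubgroup B}
    (hA : DirectSum.IsInternal 𝒜) (hB : DirectSum.IsInternal ℬ) (T : A →+ B) (c : ℤ)
    (hT : ∀ j x, x ∈ 𝒜 j → T x ∈ ℬ (j + c)) (j : ℤ) (x : A) :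
    T (proj hA j x) = proj hB (j + c) (T x) := by
  induction x using graded_induction hA with
  | zero => simp
  | add x y hx hy => simp [hx, hy]
  | mem i x hx =>
    by_cases hij : j = i
    · subst hij
      rw [proj_of_mem hA hx, proj_of_mem hB (hT _ _ hx)]
    · rw [proj_of_mem_ne hA hx hij, proj_of_mem_ne hB (hT _ _ hx) (by omega), map_zero]

end Projections

/-! ### Homogeneous components of linear maps, and homogeneous lifting -/

section GradedComponent

variable {S : Type u} [CommRing S] {𝒮 : ℕ → AddSubgroup S}
  {A : Type u} [AddCommGroup A] [Module S A] {𝒜 : ℤ → AddSubgroup A}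
  {B : Type u} [AddCommGroup B] [Module S B] {ℬ : ℤ → AddSubgroup B}

theorem IsGradedModule.proj_smul (hA : IsGradedModule 𝒮 𝒜) {n : ℕ} {s : S} (hs : s ∈ 𝒮 n)
    (j : ℤ) (x : A) :
    proj hA.isInternal (n + j) (s • x) = s • proj hA.isInternal j x := by
  have h := map_proj hA.isInternal hA.isInternal (DistribSMul.toAddMonoidHom A s) n
    (fun j x hx => by
      rw [add_comm]
      exact hA.smul_mem n j s x hs hx) j x
  rw [add_comm]
  exact h.symm

variable [GradedRing 𝒮]

/-- The homogeneous component of degree `j` of a linear map between graded modules. -/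
noncomputable def gradedComponent (hA : IsGradedModule 𝒮 𝒜) (hB : IsGradedModule 𝒮 ℬ)
    (f : A →ₗ[S] B) (j : ℤ) : A →ₗ[S] B :=
  let g : A →+ B := (DirectSum.toAddMonoid fun m =>
    ((proj hB.isInternal (m + j)).comp f.toAddMonoidHom).comp (𝒜 m).subtype).comp
      (AddEquiv.ofBijective (DirectSum.coeAddMonoidHom 𝒜) hA.isInternal).symm.toAddMonoidHom
  have hg : ∀ m x, x ∈ 𝒜 m → g x = proj hB.isInternal (m + j) (f x) := fun m x hx => by
    change DirectSum.toAddMonoid _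
      ((AddEquiv.ofBijective (DirectSum.coeAddMonoidHom 𝒜) hA.isInternal).symm x) = _
    rw [symm_of_mem hA.isInternal hx, DirectSum.toAddMonoid_of]
    rfl
  { g with
    map_smul' := fun s x => by
      change g (s • x) = s • g x
      induction x using graded_induction hA.isInternal with
      | zero => simp
      | add x y hx hy => rw [smul_add, map_add, map_add, hx, hy, smul_add]
      | mem m x hx =>
        induction s using DirectSum.Decomposition.inductionOn 𝒮 with
        | zero => simp
        | add s t hs ht => rw [add_smul, add_smul, map_add, hs, ht]
        | @homogeneous n s =>
          rw [hg _ _ (hA.smul_mem n m s x s.2 hx), hg _ _ hx, map_smul, add_assoc,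
            hB.proj_smul s.2] }

theorem gradedComponent_of_mem (hA : IsGradedModule 𝒮 𝒜) (hB : IsGradedModule 𝒮 ℬ)
    (f : A →ₗ[S] B) (j : ℤ) {m : ℤ} {x : A} (hx : x ∈ 𝒜 m) :
    gradedComponent hA hB f j x = proj hB.isInternal (m + j) (f x) := by
  change DirectSum.toAddMonoid _
    ((AddEquiv.ofBijective (DirectSum.coeAddMonoidHom 𝒜) hA.isInternal).symm x) = _
  rw [symm_of_mem hA.isInternal hx, DirectSum.toAddMonoid_of]
  rfl

theorem gradedComponent_mem (hA : IsGradedModule 𝒮 𝒜) (hB : IsGradedModule 𝒮 ℬ)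
    (f : A →ₗ[S] B) (j : ℤ) {m : ℤ} {x : A} (hx : x ∈ 𝒜 m) :
    gradedComponent hA hB f j x ∈ ℬ (m + j) := by
  rw [gradedComponent_of_mem hA hB f j hx]
  exact proj_mem _ _ _

/-- Such an `f` agrees on the basis with its own component of degree `j`, hence equals it. -/
theorem mem_of_basis_mem (hA : IsGradedModule 𝒮 𝒜) (hB : IsGradedModule 𝒮 ℬ)
    {ι : Type u} (b : Module.Basis ι S A) (deg : ι → ℤ) (hb : ∀ i, b i ∈ 𝒜 (deg i))
    (f : A →ₗ[S] B) (j : ℤ) (hf : ∀ i, f (b i) ∈ ℬ (deg i + j)) {m : ℤ} {x : A}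
    (hx : x ∈ 𝒜 m) : f x ∈ ℬ (m + j) := by
  have h : f = gradedComponent hA hB f j := b.ext fun i => by
    rw [gradedComponent_of_mem hA hB f j (hb i), proj_of_mem _ (hf i)]
  rw [h]
  exact gradedComponent_mem hA hB f j hx

/-- A homogeneous map out of a graded free module can be chosen subject to a linear relation with
a given map if this is possible for the values at each homogeneous element. -/
theorem exists_homogeneous_lift (hA : IsGradedModule 𝒮 𝒜) (hfree : IsGradedFree S 𝒜)
    (hB : IsGradedModule 𝒮 ℬ) {C : Type u} [AddCommGroup C] [Module S C]
    (h : A →ₗ[S] C) (R : Submodule S (B × C)) (j : ℤ)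
    (hR : ∀ m, ∀ x ∈ 𝒜 m, ∃ y ∈ ℬ (m + j), (y, h x) ∈ R) :
    ∃ l : A →ₗ[S] B, (∀ m x, x ∈ 𝒜 m → l x ∈ ℬ (m + j)) ∧ ∀ x, (l x, h x) ∈ R := by
  obtain ⟨ι, b, hb⟩ := hfree
  choose deg hdeg using hb
  choose y hy hyR using fun i => hR (deg i) (b i) (hdeg i)
  refine ⟨b.constr S y, fun m x hx => mem_of_basis_mem hA hB b deg hdeg _ j
    (fun i => by rw [b.constr_basis]; exact hy i) hx, fun x => ?_⟩
  -- Because `R` is a submodule, the relation only has to be checked on the basis.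
  suffices (⊤ : Submodule S A) ≤ R.comap ((b.constr S y).prod h) from this trivial
  rw [← b.span_eq, Submodule.span_le]
  rintro _ ⟨i, rfl⟩
  change ((b.constr S y) (b i), h (b i)) ∈ R
  rw [b.constr_basis]
  exact hyR i

end GradedComponent

/-! ### Comparison of homogeneous resolutions, and Ext by degree -/

section Resolutions

variable {S : Type u} [CommRing S] {𝒮 : ℕ → AddSubgroup S}
  {M : Type u} [AddCommGroup M] [Module S M] {ℳ : ℤ → AddSubgroup M}

namespace FreeResolution

variable (G : FreeResolution 𝒮 ℳ)

/-- The differential `X (n + 1) → X n` of a resolution, as a linear map. -/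
noncomputable abbrev diff (n : ℕ) : G.res.complex.X (n + 1) →ₗ[S] G.res.complex.X n :=
  (G.res.complex.d (n + 1) n).hom

/-- The augmentation of a resolution, as a linear map. -/
noncomputable def aug : G.res.complex.X 0 →ₗ[S] M := (G.res.π.f 0).hom

theorem diff_diff (n : ℕ) (x : G.res.complex.X (n + 1 + 1)) :
    G.diff n (G.diff (n + 1) x) = 0 :=
  LinearMap.congr_fun (congrArg ModuleCat.Hom.hom (G.res.complex.d_comp_d (n + 1 + 1) (n + 1) n)) x

theorem aug_diff (x : G.res.complex.X 1) : G.aug (G.diff 0 x) = 0 :=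
  LinearMap.congr_fun (congrArg ModuleCat.Hom.hom G.res.complex_d_comp_π_f_zero) x

theorem aug_surjective : Function.Surjective G.aug :=
  (ModuleCat.epi_iff_surjective (G.res.π.f 0)).1 inferInstance

theorem exists_diff_eq (n : ℕ) (x : G.res.complex.X (n + 1)) (hx : G.diff n x = 0) :
    ∃ w, G.diff (n + 1) w = x :=
  (ShortComplex.moduleCat_exact_iff _).1 (G.res.exact_succ n) x hx

theorem exists_diff_eq_of_aug (x : G.res.complex.X 0) (hx : G.aug x = 0) :
    ∃ w, G.diff 0 w = x :=
  (ShortComplex.moduleCat_exact_iff _).1 G.res.exact₀ x hx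

theorem diff_mem (n : ℕ) (j : ℤ) (x : G.res.complex.X (n + 1)) (hx : x ∈ G.grading (n + 1) j) :
    G.diff n x ∈ G.grading n j :=
  G.d_mem (n + 1) n j x hx

theorem aug_mem (j : ℤ) (x : G.res.complex.X 0) (hx : x ∈ G.grading 0 j) : G.aug x ∈ ℳ j :=
  G.π_mem j x hx

theorem extDegree_eq_bot_of_projectiveDimension_lt (F : FreeResolution 𝒮 ℳ) {N : Type u}
    [AddCommGroup N] [Module S N] (𝒩 : ℤ → AddSubgroup N) (i : ℕ) (j : ℤ)
    (h : projectiveDimension (ModuleCat.of S M) < i) : F.extDegree 𝒩 i j = ⊥ := by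
  have := projectiveDimension_lt_iff.1 h
  have := HasProjectiveDimensionLT.subsingleton (ModuleCat.of S M) i i le_rfl (ModuleCat.of S N)
  exact Subsingleton.elim _ _

variable [GradedRing 𝒮]

/-- Between two homogeneous free resolutions there is a comparison map of degree `0`. -/
theorem exists_homogeneous_comparison (hM : IsGradedModule 𝒮 ℳ) (F G : FreeResolution 𝒮 ℳ) :
    ∃ φ : ProjectiveResolution.Hom F.res G.res (𝟙 (ModuleCat.of S M)),
      ∀ n j x, x ∈ F.grading n j → (φ.hom.f n).hom x ∈ G.grading n j := by
  let c := ProjectiveResolution.lift (𝟙 (ModuleCat.of S M)) F.res G.res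
  -- The lift `c` need not preserve degrees. Its degree `0` part does, and it is still a chain map
  -- over the identity because differentials and augmentations have degree `0`.
  let l : ∀ n, F.res.complex.X n →ₗ[S] G.res.complex.X n := fun n =>
    gradedComponent (F.isGraded n) (G.isGraded n) (c.f n).hom 0
  have hl : ∀ n j x, x ∈ F.grading n j → l n x ∈ G.grading n j := fun n j x hx => by
    simpa using gradedComponent_mem (F.isGraded n) (G.isGraded n) (c.f n).hom 0 hx
  have hcomm : ∀ n x, G.diff n (l (n + 1) x) = l n (F.diff n x) := by
    intro n x
    induction x using graded_induction (F.isGraded (n + 1)).isInternal with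
    | zero => simp
    | add x y hx hy => simp only [map_add, hx, hy]
    | mem j x hx =>
      rw [gradedComponent_of_mem _ _ _ _ hx, gradedComponent_of_mem _ _ _ _ (F.diff_mem n j x hx),
        ← LinearMap.toAddMonoidHom_coe (G.diff n),
        map_proj (G.isGraded (n + 1)).isInternal (G.isGraded n).isInternal _ 0
          (fun j x hx => by simpa using G.diff_mem n j x hx), add_zero, add_zero]
      congr 1
      exact LinearMap.congr_fun (congrArg ModuleCat.Hom.hom (c.comm (n + 1) n)) x
  have haug : ∀ x, G.aug (l 0 x) = F.aug x := by
    intro x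
    induction x using graded_induction (F.isGraded 0).isInternal with
    | zero => simp
    | add x y hx hy => simp only [map_add, hx, hy]
    | mem j x hx =>
      rw [gradedComponent_of_mem _ _ _ _ hx, ← LinearMap.toAddMonoidHom_coe G.aug,
        map_proj (G.isGraded 0).isInternal hM.isInternal _ 0
          (fun j x hx => by simpa using G.aug_mem j x hx), add_zero, add_zero]
      have h : G.aug ((c.f 0).hom x) = F.aug x :=
        LinearMap.congr_fun (congrArg ModuleCat.Hom.hom
          (ProjectiveResolution.lift_commutes_zero (𝟙 (ModuleCat.of S M)) F.res G.res)) x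
      exact (congrArg _ h).trans (proj_of_mem hM.isInternal (F.aug_mem j x hx))
  refine ⟨⟨{ f := fun n => ModuleCat.ofHom (l n), comm' := ?_ }, ?_⟩, hl⟩
  · rintro i k hik
    obtain rfl : k + 1 = i := hik
    ext x
    exact hcomm k x
  · ext x
    exact haug x

/-- If `Ext^n_S(M, N)_j` vanishes, then all cocycles of degree `j` on any homogeneous free resolution
are coboundaries of cochains of degree `j`. -/
theorem exists_homogeneous_coboundary (hM : IsGradedModule 𝒮 ℳ)
    {N : Type u} [AddCommGroup N] [Module S N] {𝒩 : ℤ → AddSubgroup N}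
    (hN : IsGradedModule 𝒮 𝒩) (F G : FreeResolution 𝒮 ℳ) (n : ℕ) (j : ℤ)
    (hExt : F.extDegree 𝒩 (n + 1) j = ⊥) (f : G.res.complex.X (n + 1) →ₗ[S] N)
    (hf : ∀ x, f (G.diff (n + 1) x) = 0)
    (hfj : ∀ m x, x ∈ G.grading (n + 1) m → f x ∈ 𝒩 (m + j)) :
    ∃ g : G.res.complex.X n →ₗ[S] N, (∀ m x, x ∈ G.grading n m → g x ∈ 𝒩 (m + j)) ∧
      ∀ x, g (G.diff n x) = f x := by
  obtain ⟨φ, hφ⟩ := exists_homogeneous_comparison hM F G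
  let f' : G.res.complex.X (n + 1) ⟶ ModuleCat.of S N := ModuleCat.ofHom f
  have hf' : G.res.complex.d (n + 1 + 1) (n + 1) ≫ f' = 0 := by
    ext x
    exact hf x
  -- Composition with `φ` represents the class of `f` by a cocycle on `F`, again homogeneous of
  -- degree `j`.
  have h := ProjectiveResolution.mk₀_comp_extMk f' (n + 1 + 1) rfl hf' φ
  rw [Abelian.Ext.mk₀_id_comp] at h
  have hmem : G.res.extMk f' (n + 1 + 1) rfl hf' ∈ F.extDegree 𝒩 (n + 1) j :=
    ⟨_, _, fun m x hx => hfj m _ (hφ (n + 1) m x hx), h.symm⟩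
  rw [hExt, AddSubgroup.mem_bot, ProjectiveResolution.extMk_eq_zero_iff _ _ _ _ _ n rfl] at hmem
  obtain ⟨g, hg⟩ := hmem
  -- The cochain `g` may be inhomogeneous. As `f` has degree `j`, the degree `j` part of `g` has the
  -- same coboundary.
  refine ⟨gradedComponent (G.isGraded n) hN g.hom j,
    fun m x hx => gradedComponent_mem _ _ _ _ hx, fun x => ?_⟩
  induction x using graded_induction (G.isGraded (n + 1)).isInternal with
  | zero => simp
  | add x y hx hy => simp only [map_add, hx, hy]
  | mem m x hx =>
    rw [gradedComponent_of_mem _ _ _ _ (G.diff_mem n m x hx)]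
    have h' : g.hom (G.diff n x) = f x := LinearMap.congr_fun (congrArg ModuleCat.Hom.hom hg) x
    rw [h', proj_of_mem _ (hfj m x hx)]

end FreeResolution

end Resolutions

/-! ### Stepwise construction of maps out of a fold -/

section Obstruction

variable {S : Type u} [CommRing S] {𝒮 : ℕ → AddSubgroup S} {a : ℤ}
  {M : Type u} [AddCommGroup M] [Module S M] {ℳ : ℤ → AddSubgroup M}

theorem DM.d_proj (D : DM 𝒮 a) (j : ℤ) (x : D.carrier) :
    D.d (proj D.isGraded.isInternal j x) = proj D.isGraded.isInternal (j + a) (D.d x) :=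
  map_proj D.isGraded.isInternal D.isGraded.isInternal D.d.toAddMonoidHom a D.d_mem j x

theorem DM.exists_homogeneous_d_eq (D : DM 𝒮 a) {j : ℤ} {z : D.carrier}
    (hz : z ∈ D.grading (j + a)) {y : D.carrier} (hy : D.d y = z) :
    D.d (proj D.isGraded.isInternal j y) = z := by
  rw [D.d_proj, hy, proj_of_mem _ hz]

/-- One step of the construction of a map from the fold of a resolution `G` to a differential
module `D` whose homology is computed by `φ₀ : G₀ → D`: if `φ : Gₙ → D` sends boundaries to
boundaries, it has a lift `Gₙ₊₁ → D` with the same property, which can be chosen within `N'` of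
a given approximate lift `Φ'`. -/
theorem FreeResolution.exists_next [GradedRing 𝒮] (hM : IsGradedModule 𝒮 ℳ) (G : FreeResolution 𝒮 ℳ)
    (D : DM 𝒮 a) (n : ℕ) (c : ℤ)
    (hcob : ∀ f : G.res.complex.X (n + 2) →ₗ[S] M, (∀ x, f (G.diff (n + 2) x) = 0) →
      (∀ m x, x ∈ G.grading (n + 2) m → f x ∈ ℳ (m + c)) →
      ∃ g : G.res.complex.X (n + 1) →ₗ[S] M,
        (∀ m x, x ∈ G.grading (n + 1) m → g x ∈ ℳ (m + c)) ∧ ∀ x, g (G.diff (n + 1) x) = f x)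
    (φ₀ : G.res.complex.X 0 →ₗ[S] D.carrier)
    (hφ₀ : ∀ m x, x ∈ G.grading 0 m → φ₀ x ∈ D.grading m) (hdφ₀ : ∀ x, D.d (φ₀ x) = 0)
    (hcycle : ∀ z, D.d z = 0 → ∃ x, z - φ₀ x ∈ LinearMap.range D.d)
    (hbdry : ∀ x, φ₀ x ∈ LinearMap.range D.d ↔ G.aug x = 0)
    (N N' : Submodule S D.carrier) (hN' : ∀ j x, x ∈ N' → proj D.isGraded.isInternal j x ∈ N')
    (hφN' : ∀ x, φ₀ x ∈ N') (hNN' : ∀ z ∈ N, z ∈ LinearMap.range D.d → ∃ y ∈ N', D.d y = z)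
    (Φ φ : G.res.complex.X n →ₗ[S] D.carrier) (Φ' : G.res.complex.X (n + 1) →ₗ[S] D.carrier)
    (hΦ' : ∀ m x, x ∈ G.grading (n + 1) m → Φ' x ∈ D.grading (m + c))
    (hΦ : ∀ x, D.d (Φ' x) - Φ (G.diff n x) ∈ N)
    (hφ : ∀ m x, x ∈ G.grading n m → φ x ∈ D.grading (m + (c + a)))
    (hφN : ∀ x, φ x - Φ x ∈ N) (hφd : ∀ x, φ (G.diff n x) ∈ LinearMap.range D.d) :
    ∃ φ' : G.res.complex.X (n + 1) →ₗ[S] D.carrier,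
      (∀ m x, x ∈ G.grading (n + 1) m → φ' x ∈ D.grading (m + c)) ∧
      (∀ x, φ' x - Φ' x ∈ N') ∧ (∀ x, φ' (G.diff (n + 1) x) ∈ LinearMap.range D.d) ∧
      ∀ x, D.d (φ' x) = φ (G.diff n x) := by
  -- The relation asks for `d l = φ ∂ - d Φ'` with values of `l` in `N'`. The right side is a
  -- boundary, and lies in `N` as the difference of the errors in `hφN` and `hΦ`.
  obtain ⟨l, hl, hlR⟩ := exists_homogeneous_lift (G.isGraded (n + 1)) (G.free (n + 1)) D.isGraded
    (φ ∘ₗ G.diff n - D.d ∘ₗ Φ') (D.d.graph ⊓ N'.comap (LinearMap.fst S _ _)) c (by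
      intro m x hx
      have hz : φ (G.diff n x) - D.d (Φ' x) ∈ D.grading (m + c + a) := by
        refine sub_mem ?_ (D.d_mem _ _ (hΦ' m x hx))
        rw [add_assoc]
        exact hφ _ _ (G.diff_mem n m x hx)
      obtain ⟨y, hy, hyz⟩ := hNN' (φ (G.diff n x) - D.d (Φ' x)) (by
        have := sub_mem (hφN (G.diff n x)) (hΦ x)
        convert this using 1
        abel) (sub_mem (hφd x) ⟨_, rfl⟩)
      exact ⟨_, proj_mem D.isGraded.isInternal (m + c) y,
        (D.exists_homogeneous_d_eq hz hyz).symm, hN' _ _ hy⟩)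
  let ψ := Φ' + l
  have hψ : ∀ m x, x ∈ G.grading (n + 1) m → ψ x ∈ D.grading (m + c) :=
    fun m x hx => add_mem (hΦ' m x hx) (hl m x hx)
  have hdψ : ∀ x, D.d (ψ x) = φ (G.diff n x) := fun x => by
    have h : φ (G.diff n x) - D.d (Φ' x) = D.d (l x) := (hlR x).1
    change D.d (Φ' x + l x) = _
    rw [map_add, ← h, add_sub_cancel]
  -- Since `d ψ ∂ = φ ∂ ∂ = 0`, the values of `ψ ∂` are cycles, homologous to values of `φ₀`. The
  -- map `h` records these, so `aug ∘ h` is the obstruction cocycle.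
  obtain ⟨h, hh, hhR⟩ := exists_homogeneous_lift (G.isGraded (n + 2)) (G.free (n + 2))
    (G.isGraded 0) (ψ ∘ₗ G.diff (n + 1))
    ((LinearMap.range D.d).comap (LinearMap.snd S _ _ - φ₀ ∘ₗ LinearMap.fst S _ _)) c (by
      intro m x hx
      obtain ⟨u, v, hv⟩ := hcycle (ψ (G.diff (n + 1) x)) (by rw [hdψ, G.diff_diff, map_zero])
      refine ⟨_, proj_mem (G.isGraded 0).isInternal (m + c) u,
        proj D.isGraded.isInternal (m + c - a) v, ?_⟩
      have h1 := map_proj (G.isGraded 0).isInternal D.isGraded.isInternal φ₀.toAddMonoidHom 0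
        (fun j x hx => by simpa using hφ₀ j x hx) (m + c) u
      rw [add_zero] at h1
      rw [D.d_proj, hv, map_sub, sub_add_cancel,
        proj_of_mem _ (hψ _ _ (G.diff_mem (n + 1) m x hx))]
      exact congrArg _ h1.symm)
  obtain ⟨g, hg, hgh⟩ := hcob (G.aug ∘ₗ h) (fun x => by
    refine (hbdry _).1 ?_
    have h1 := hhR (G.diff (n + 2) x)
    have h2 : ψ (G.diff (n + 1) (G.diff (n + 2) x)) - φ₀ (h (G.diff (n + 2) x)) ∈
      LinearMap.range D.d := h1
    rwa [G.diff_diff, map_zero, zero_sub, neg_mem_iff] at h2)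
    (fun m x hx => G.aug_mem _ _ (hh m x hx))
  -- Lift the bounding cochain `g` through the augmentation.
  obtain ⟨γ, hγ, hγR⟩ := exists_homogeneous_lift (G.isGraded (n + 1)) (G.free (n + 1))
    (G.isGraded 0) g G.aug.graph c (by
      intro m x hx
      obtain ⟨u, hu⟩ := G.aug_surjective (g x)
      refine ⟨_, proj_mem (G.isGraded 0).isInternal (m + c) u, ?_⟩
      have h1 := map_proj (G.isGraded 0).isInternal hM.isInternal G.aug.toAddMonoidHom 0
        (fun j x hx => by simpa using G.aug_mem j x hx) (m + c) u
      rw [add_zero] at h1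
      refine Eq.trans ?_ h1.symm
      change g x = proj hM.isInternal (m + c) (G.aug u)
      rw [hu, proj_of_mem _ (hg m x hx)])
  -- The correction is cycle-valued with values in `N'`. Modulo boundaries, `(ψ - φ₀ γ) ∂` is `φ₀ (h
  -- - γ ∂)`, and `aug` kills `h - γ ∂`.
  refine ⟨ψ - φ₀ ∘ₗ γ, fun m x hx => sub_mem (hψ m x hx) (hφ₀ _ _ (hγ m x hx)), fun x => ?_,
    fun x => ?_, fun x => ?_⟩
  · have h1 : (ψ - φ₀ ∘ₗ γ) x - Φ' x = l x - φ₀ (γ x) := by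
      change Φ' x + l x - φ₀ (γ x) - Φ' x = _
      abel
    rw [h1]
    exact sub_mem (hlR x).2 (hφN' _)
  · have h1 : ψ (G.diff (n + 1) x) - φ₀ (h x) ∈ LinearMap.range D.d := hhR x
    have h2 : φ₀ (h x - γ (G.diff (n + 1) x)) ∈ LinearMap.range D.d := by
      rw [hbdry, map_sub, sub_eq_zero]
      exact (hgh x).symm.trans (hγR (G.diff (n + 1) x))
    have h3 := add_mem h1 h2
    rw [map_sub, sub_add_sub_cancel] at h3
    exact h3
  · change D.d (ψ x - φ₀ (γ x)) = _
    rw [map_sub, hdψ, hdφ₀, sub_zero]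

/-- A map `φ₀ : G₀ → D` computing the homology of `D` extends to a map from the fold of `G`,
with components `φ n` that agree with given approximate ones `Φ n` modulo `N n`. -/
theorem FreeResolution.exists_fold_map [GradedRing 𝒮] (hM : IsGradedModule 𝒮 ℳ)
    (G : FreeResolution 𝒮 ℳ)
    (D : DM 𝒮 a)
    (hcob : ∀ (n : ℕ) (f : G.res.complex.X (n + 2) →ₗ[S] M), (∀ x, f (G.diff (n + 2) x) = 0) →
      (∀ m x, x ∈ G.grading (n + 2) m → f x ∈ ℳ (m + -((n + 1 : ℕ) * a))) →
      ∃ g : G.res.complex.X (n + 1) →ₗ[S] M,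
        (∀ m x, x ∈ G.grading (n + 1) m → g x ∈ ℳ (m + -((n + 1 : ℕ) * a))) ∧
          ∀ x, g (G.diff (n + 1) x) = f x)
    (N : ℕ → Submodule S D.carrier)
    (hN : ∀ n j x, x ∈ N n → proj D.isGraded.isInternal j x ∈ N n)
    (hNN : ∀ n, ∀ z ∈ N n, z ∈ LinearMap.range D.d → ∃ y ∈ N (n + 1), D.d y = z)
    (Φ : ∀ n, G.res.complex.X n →ₗ[S] D.carrier)
    (hΦ : ∀ n m x, x ∈ G.grading n m → Φ n x ∈ D.grading (m + -(n * a)))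
    (hdΦ : ∀ n x, D.d (Φ (n + 1) x) - Φ n (G.diff n x) ∈ N n)
    (φ₀ : G.res.complex.X 0 →ₗ[S] D.carrier)
    (hφ₀ : ∀ m x, x ∈ G.grading 0 m → φ₀ x ∈ D.grading m) (hdφ₀ : ∀ x, D.d (φ₀ x) = 0)
    (hφ₀N : ∀ n x, φ₀ x ∈ N (n + 1)) (hφ₀Φ : ∀ x, φ₀ x - Φ 0 x ∈ N 0)
    (hcycle : ∀ z, D.d z = 0 → ∃ x, z - φ₀ x ∈ LinearMap.range D.d)
    (hbdry : ∀ x, φ₀ x ∈ LinearMap.range D.d ↔ G.aug x = 0) :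
    ∃ φ : ∀ n, G.res.complex.X n →ₗ[S] D.carrier,
      (∀ n m x, x ∈ G.grading n m → φ n x ∈ D.grading (m + -(n * a))) ∧
      (∀ n x, φ n x - Φ n x ∈ N n) ∧ (∀ n x, D.d (φ (n + 1) x) = φ n (G.diff n x)) ∧
      φ 0 = φ₀ := by
  -- The last clause is what permits the next lift, so the recursion runs over maps bundled with
  -- `P`.
  let P : ∀ n, (G.res.complex.X n →ₗ[S] D.carrier) → Prop := fun n φ =>
    (∀ m x, x ∈ G.grading n m → φ x ∈ D.grading (m + -(n * a))) ∧
      (∀ x, φ x - Φ n x ∈ N n) ∧ ∀ x, φ (G.diff n x) ∈ LinearMap.range D.d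
  have h0 : P 0 φ₀ := ⟨by simpa using hφ₀, hφ₀Φ, fun x => (hbdry _).2 (G.aug_diff x)⟩
  have hstep : ∀ n (φ : {φ // P n φ}), ∃ φ' : {φ' // P (n + 1) φ'},
      ∀ x, D.d (φ'.1 x) = φ.1 (G.diff n x) := by
    rintro n ⟨φ, h1, h2, h3⟩
    obtain ⟨φ', h1', h2', h3', h4'⟩ := G.exists_next hM D n (-((n + 1 : ℕ) * a)) (hcob n) φ₀ hφ₀ hdφ₀
      hcycle hbdry (N n) (N (n + 1)) (hN (n + 1)) (hφ₀N n) (hNN n) (Φ n) φ (Φ (n + 1))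
      (hΦ (n + 1)) (hdΦ n) (fun m x hx => by
        have h := h1 m x hx
        have e : -(((n + 1 : ℕ) : ℤ) * a) + a = -(n * a) := by
          push_cast
          ring
        rwa [e]) h2 h3
    exact ⟨⟨φ', h1', h2', h3'⟩, h4'⟩
  choose next hnext using hstep
  let φ : ∀ n, {φ // P n φ} := fun n => Nat.rec ⟨φ₀, h0⟩ next n
  exact ⟨fun n => (φ n).1, fun n => (φ n).2.1, fun n => (φ n).2.2.1, fun n => hnext n (φ n), rfl⟩

end Obstruction

/-! ### Quasi-isomorphisms out of the fold of a resolution -/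

section FoldMap

variable {S : Type u} [CommRing S] {𝒮 : ℕ → AddSubgroup S} {a : ℤ}
  {M : Type u} [AddCommGroup M] [Module S M] {ℳ : ℤ → AddSubgroup M}

theorem DM.mk_eq_zero_iff (D : DM 𝒮 a) (z : LinearMap.ker D.d) :
    (Submodule.Quotient.mk z : D.Homology) = 0 ↔ (z : D.carrier) ∈ LinearMap.range D.d :=
  Submodule.Quotient.mk_eq_zero _

/-- The map from the fold of a complex to a differential module with given components. -/
noncomputable def HomogeneousComplex.foldDesc (K : HomogeneousComplex 𝒮) (D : DM 𝒮 a)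
    (φ : ∀ n, K.complex.X n →ₗ[S] D.carrier)
    (hφ : ∀ n m x, x ∈ K.grading n m → φ n x ∈ D.grading (m + -(n * a)))
    (hφ₀ : ∀ x, D.d (φ 0 x) = 0)
    (hd : ∀ n x, D.d (φ (n + 1) x) = φ n ((K.complex.d (n + 1) n).hom x)) :
    DM.Hom (K.fold a) D where
  toLinearMap := DirectSum.toModule S ℕ D.carrier φ
  map_mem := fun j x hx => by
    classical
    change DirectSum.toModule S ℕ D.carrier φ x ∈ _
    rw [← DirectSum.sum_support_of (x : ⨁ i, K.complex.X i), map_sum]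
    refine sum_mem fun i _ => ?_
    rw [← DirectSum.lof_eq_of S, DirectSum.toModule_lof]
    have h := hφ i _ _ (hx i)
    rwa [add_neg_cancel_right] at h
  comm := fun x => by
    change D.d (DirectSum.toModule S ℕ D.carrier φ x) =
      DirectSum.toModule S ℕ D.carrier φ (K.foldD x)
    induction x using DirectSum.induction_on with
    | zero => simp
    | add x y hx hy => simp only [map_add, hx, hy]
    | of n x =>
      rw [← DirectSum.lof_eq_of S, DirectSum.toModule_lof]
      cases n with
      | zero => rw [K.foldD_lof_zero, map_zero, hφ₀]
      | succ n => rw [K.foldD_lof_succ, DirectSum.toModule_lof, hd]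

theorem HomogeneousComplex.foldDesc_lof (K : HomogeneousComplex 𝒮) (D : DM 𝒮 a)
    (φ : ∀ n, K.complex.X n →ₗ[S] D.carrier)
    (hφ : ∀ n m x, x ∈ K.grading n m → φ n x ∈ D.grading (m + -(n * a)))
    (hφ₀ : ∀ x, D.d (φ 0 x) = 0)
    (hd : ∀ n x, D.d (φ (n + 1) x) = φ n ((K.complex.d (n + 1) n).hom x)) (n : ℕ)
    (x : K.complex.X n) :
    (K.foldDesc D φ hφ hφ₀ hd).toLinearMap
      (DirectSum.lof S ℕ (fun i => K.complex.X i) n x) = φ n x :=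
  DirectSum.toModule_lof (φ := φ) S n x

/-- A cycle in the fold of a resolution is a boundary if its component in degree `0` is. -/
theorem FreeResolution.mem_range_foldD (G : FreeResolution 𝒮 ℳ) (x : G.toComplex.FoldModule)
    (hx : G.toComplex.foldD x = 0) (hx₀ : G.aug (x 0) = 0) :
    x ∈ LinearMap.range G.toComplex.foldD := by
  classical
  have h : ∀ i, ∃ w, G.diff i w = x i := by
    rintro (_ | i)
    · exact G.exists_diff_eq_of_aug _ hx₀
    · refine G.exists_diff_eq i _ ?_
      exact (G.toComplex.foldD_apply x i).symm.trans (by rw [hx]; rfl)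
  rw [← DirectSum.sum_support_of x]
  refine sum_mem fun i _ => ?_
  obtain ⟨w, hw⟩ := h i
  exact ⟨DirectSum.lof S ℕ (fun i => G.toComplex.complex.X i) (i + 1) w,
    (G.toComplex.foldD_lof_succ i w).trans (congrArg _ hw)⟩

/-- A morphism from the fold of a resolution is a quasi-isomorphism if its component in degree `0`
computes the homology of the target. -/
theorem FreeResolution.isQuasiIso_of_zero (G : FreeResolution 𝒮 ℳ) (D : DM 𝒮 a)
    (f : DM.Hom (G.toComplex.fold a) D) (φ₀ : G.res.complex.X 0 →ₗ[S] D.carrier)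
    (hf : ∀ x, f.toLinearMap (DirectSum.lof S ℕ (fun i => G.toComplex.complex.X i) 0 x) = φ₀ x)
    (hcycle : ∀ z, D.d z = 0 → ∃ x, z - φ₀ x ∈ LinearMap.range D.d)
    (hbdry : ∀ x, φ₀ x ∈ LinearMap.range D.d ↔ G.aug x = 0) : f.IsQuasiIso := by
  let ι := DirectSum.lof S ℕ (fun i => G.toComplex.complex.X i) 0
  -- The cycle `x - ι (x 0)` has no component in degree `0`, so it bounds. Hence `φ₀ (x 0)` differs
  -- from `f x` by a boundary, which forces `aug (x 0) = 0`.
  have key : ∀ x : G.toComplex.FoldModule, G.toComplex.foldD x = 0 →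
      f.toLinearMap x ∈ LinearMap.range D.d → x ∈ LinearMap.range G.toComplex.foldD := by
    intro x hx hfx
    have hxι : G.toComplex.foldD (x - ι (x 0)) = 0 := by
      rw [map_sub, hx, G.toComplex.foldD_lof_zero, sub_zero]
    have h₀ : (x - ι (x 0)) 0 = 0 := by
      change x 0 - ι (x 0) 0 = 0
      rw [DirectSum.lof_apply, sub_self]
    obtain ⟨w, hw⟩ := G.mem_range_foldD _ hxι ((congrArg G.aug h₀).trans (map_zero _))
    refine G.mem_range_foldD x hx ((hbdry _).1 ?_)
    have h1 : φ₀ (x 0) = f.toLinearMap x - D.d (f.toLinearMap w) := by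
      have h2 : f.toLinearMap (x - ι (x 0)) = D.d (f.toLinearMap w) :=
        (congrArg f.toLinearMap hw).symm.trans (f.comm w).symm
      rw [← h2, ← hf]
      exact (sub_sub_cancel _ _).symm.trans (congrArg _ (map_sub f.toLinearMap x (ι (x 0))).symm)
    rw [h1]
    exact sub_mem hfx ⟨_, rfl⟩
  constructor
  · rw [injective_iff_map_eq_zero]
    intro y hy
    obtain ⟨⟨x, hx⟩, rfl⟩ := Submodule.Quotient.mk_surjective _ y
    exact (Submodule.Quotient.mk_eq_zero _).2 (key x hx ((D.mk_eq_zero_iff _).1 hy))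
  · intro y
    obtain ⟨⟨z, hz⟩, rfl⟩ := Submodule.Quotient.mk_surjective _ y
    obtain ⟨x, hx⟩ := hcycle z hz
    rw [← hf x] at hx
    exact ⟨Submodule.Quotient.mk ⟨ι x, G.toComplex.foldD_lof_zero x⟩,
      ((Submodule.Quotient.eq ((LinearMap.range D.d).submoduleOf (LinearMap.ker D.d))).2 hx).symm⟩

/-- A differential module with homology `M` admits a map from the degree `0` term of a
resolution of `M` that computes the homology. -/
theorem FreeResolution.exists_zero_map [GradedRing 𝒮] (G : FreeResolution 𝒮 ℳ) (D : DM 𝒮 a)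
    (hD : D.HasHomology ℳ) :
    ∃ φ₀ : G.res.complex.X 0 →ₗ[S] D.carrier,
      (∀ m x, x ∈ G.grading 0 m → φ₀ x ∈ D.grading m) ∧ (∀ x, D.d (φ₀ x) = 0) ∧
      (∀ z, D.d z = 0 → ∃ x, z - φ₀ x ∈ LinearMap.range D.d) ∧
      ∀ x, φ₀ x ∈ LinearMap.range D.d ↔ G.aug x = 0 := by
  obtain ⟨e, he⟩ := hD
  let q : LinearMap.ker D.d →ₗ[S] M :=
    e.toLinearMap ∘ₗ ((LinearMap.range D.d).submoduleOf (LinearMap.ker D.d)).mkQ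
  have hq : ∀ z : LinearMap.ker D.d, q z = 0 ↔ (z : D.carrier) ∈ LinearMap.range D.d := by
    intro z
    change e (Submodule.Quotient.mk z) = 0 ↔ _
    rw [LinearEquiv.map_eq_zero_iff, D.mk_eq_zero_iff]
  -- The relation consists of the pairs `(z, q z)` with `z` a cycle: `φ₀ x` is to be a cycle
  -- representing `aug x`.
  obtain ⟨φ₀, hφ₀, hR⟩ := exists_homogeneous_lift (G.isGraded 0) (G.free 0) D.isGraded G.aug
    (LinearMap.range ((LinearMap.ker D.d).subtype.prod q)) 0 (by
      intro m x hx
      obtain ⟨z, hz, hzx⟩ := (he m (e.symm (G.aug x))).2 (by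
        rw [e.apply_symm_apply]
        exact G.aug_mem m x hx)
      refine ⟨z, by simpa using hz, z, Prod.ext rfl ?_⟩
      change e (Submodule.Quotient.mk z) = G.aug x
      rw [← e.apply_symm_apply (G.aug x), ← hzx]
      rfl)
  have hR' : ∀ x, ∃ z : LinearMap.ker D.d, (z : D.carrier) = φ₀ x ∧ q z = G.aug x := fun x => by
    obtain ⟨z, hz⟩ := hR x
    exact ⟨z, congrArg Prod.fst hz, congrArg Prod.snd hz⟩
  refine ⟨φ₀, by simpa using hφ₀, fun x => ?_, fun z hz => ?_, fun x => ?_⟩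
  · obtain ⟨z, hz, -⟩ := hR' x
    rw [← hz]
    exact z.2
  · obtain ⟨x, hx⟩ := G.aug_surjective (q ⟨z, hz⟩)
    obtain ⟨z', hz', hqz'⟩ := hR' x
    refine ⟨x, ?_⟩
    rw [← hz']
    exact (hq (⟨z, hz⟩ - z')).1 (by rw [map_sub, hqz', hx, sub_self])
  · obtain ⟨z, hz, hqz⟩ := hR' x
    rw [← hz, ← hqz, hq]

theorem FreeResolution.quasiIsomorphic_fold [GradedRing 𝒮] (hM : IsGradedModule 𝒮 ℳ)
    (G : FreeResolution 𝒮 ℳ) (D : DM 𝒮 a) (hD : D.HasHomology ℳ)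
    (hcob : ∀ (n : ℕ) (f : G.res.complex.X (n + 2) →ₗ[S] M), (∀ x, f (G.diff (n + 2) x) = 0) →
      (∀ m x, x ∈ G.grading (n + 2) m → f x ∈ ℳ (m + -((n + 1 : ℕ) * a))) →
      ∃ g : G.res.complex.X (n + 1) →ₗ[S] M,
        (∀ m x, x ∈ G.grading (n + 1) m → g x ∈ ℳ (m + -((n + 1 : ℕ) * a))) ∧
          ∀ x, g (G.diff (n + 1) x) = f x) :
    D.QuasiIsomorphic (G.toComplex.fold a) := by
  obtain ⟨φ₀, hφ₀, hdφ₀, hcycle, hbdry⟩ := G.exists_zero_map D hD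
  -- No control of the lifts is needed here: `N n = ⊤` and `Φ n = 0` make the approximation
  -- conditions vacuous.
  obtain ⟨φ, hφ, -, hdφ, rfl⟩ := G.exists_fold_map hM D hcob (fun _ => ⊤) (fun _ _ _ _ => trivial)
    (fun _ _ _ ⟨y, hy⟩ => ⟨y, trivial, hy⟩) (fun _ => 0) (fun _ _ _ _ => zero_mem _)
    (fun _ _ => trivial) φ₀ hφ₀ hdφ₀ (fun _ _ => trivial) (fun _ => trivial) hcycle hbdry
  refine Relation.EqvGen.symm _ _ (Relation.EqvGen.rel _ _
    ⟨G.toComplex.foldDesc D φ hφ hdφ₀ hdφ, ?_⟩)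
  exact G.isQuasiIso_of_zero D _ (φ 0) (G.toComplex.foldDesc_lof D φ hφ hdφ₀ hdφ 0) hcycle hbdry

end FoldMap

/-! ### Anchored free flags and rigidity -/

section Flags

variable {S : Type u} [CommRing S] {𝒮 : ℕ → AddSubgroup S} {a : ℤ}
  {M : Type u} [AddCommGroup M] [Module S M] {ℳ : ℤ → AddSubgroup M}
  {D : DM 𝒮 a}

namespace DM.FreeFlag

variable (L : D.FreeFlag)

/-- The step `⨁ j < n, F j` of the filtration of a free flag. -/
def filtration (n : ℕ) : Submodule S D.carrier := ⨆ j, ⨆ _ : j < n, L.piece j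

theorem piece_le_filtration {i n : ℕ} (h : i < n) : L.piece i ≤ L.filtration n :=
  le_iSup₂_of_le i h le_rfl

theorem filtration_mono {m n : ℕ} (h : m ≤ n) : L.filtration m ≤ L.filtration n :=
  iSup₂_le fun _ hi => L.piece_le_filtration (hi.trans_le h)

theorem filtration_zero : L.filtration 0 = ⊥ := by
  simp [filtration]

theorem filtration_succ (n : ℕ) : L.filtration (n + 1) = L.piece n ⊔ L.filtration n := by
  refine le_antisymm (iSup₂_le fun i hi => ?_)
    (sup_le (L.piece_le_filtration n.lt_succ_self) (L.filtration_mono n.le_succ))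
  obtain rfl | h := (Nat.lt_succ_iff.1 hi).eq_or_lt
  · exact le_sup_left
  · exact (L.piece_le_filtration h).trans le_sup_right

theorem exists_mem_filtration (x : D.carrier) : ∃ n, x ∈ L.filtration n := by
  have h : x ∈ ⨆ i, L.piece i := by
    rw [L.isInternal.submodule_iSup_eq_top]
    trivial
  induction h using Submodule.iSup_induction' with
  | mem i x hx => exact ⟨i + 1, L.piece_le_filtration i.lt_succ_self hx⟩
  | zero => exact ⟨0, zero_mem _⟩
  | add x y _ _ hx hy =>
    obtain ⟨m, hm⟩ := hx
    obtain ⟨n, hn⟩ := hy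
    exact ⟨max m n, add_mem (L.filtration_mono (le_max_left _ _) hm)
      (L.filtration_mono (le_max_right _ _) hn)⟩

theorem disjoint_piece_filtration (n : ℕ) : Disjoint (L.piece n) (L.filtration n) := by
  refine (L.isInternal.submodule_iSupIndep n).mono_right (iSup₂_le fun i hi => ?_)
  exact le_iSup₂_of_le i hi.ne le_rfl

theorem d_mem_filtration {n : ℕ} {x : D.carrier} (hx : x ∈ L.filtration (n + 1)) :
    D.d x ∈ L.filtration n := by
  suffices L.filtration (n + 1) ≤ (L.filtration n).comap D.d from this hx
  refine iSup₂_le fun i hi x hx => ?_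
  exact L.filtration_mono (Nat.lt_succ_iff.1 hi) (L.d_mem i x hx)

theorem d_eq_zero_of_mem_filtration_one {x : D.carrier} (hx : x ∈ L.filtration 1) :
    D.d x = 0 := by
  have h := L.d_mem_filtration hx
  rwa [L.filtration_zero, Submodule.mem_bot] at h

end DM.FreeFlag

/-- A free flag anchored on a homogeneous free resolution, with a chosen isomorphism. -/
structure FreeResolution.Anchor (G : FreeResolution 𝒮 ℳ) (L : D.FreeFlag) where
  equiv : ∀ i, G.res.complex.X i ≃ₗ[S] L.piece i
  mem_iff : ∀ (i : ℕ) (j : ℤ) x, x ∈ G.grading i (j + i * a) ↔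
    (equiv i x : D.carrier) ∈ D.grading j
  d_sub_mem : ∀ i x, D.d (equiv (i + 1) x : D.carrier) - (equiv i (G.diff i x) : D.carrier) ∈
    L.filtration i

namespace FreeResolution.Anchor

variable {G : FreeResolution 𝒮 ℳ} {L : D.FreeFlag} (A : G.Anchor L)

/-- The inclusion of the `n`-th module of the resolution into the flag. -/
noncomputable def incl (n : ℕ) : G.res.complex.X n →ₗ[S] D.carrier :=
  (L.piece n).subtype ∘ₗ (A.equiv n).toLinearMap

theorem incl_mem_piece (n : ℕ) (x : G.res.complex.X n) : A.incl n x ∈ L.piece n :=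
  (A.equiv n x).2

theorem incl_mem_filtration {i n : ℕ} (h : i < n) (x : G.res.complex.X i) :
    A.incl i x ∈ L.filtration n :=
  L.piece_le_filtration h (A.incl_mem_piece i x)

theorem incl_mem (n : ℕ) (m : ℤ) (x : G.res.complex.X n) (hx : x ∈ G.grading n m) :
    A.incl n x ∈ D.grading (m + -(n * a)) :=
  (A.mem_iff n _ x).1 (by rwa [neg_add_cancel_right])

theorem exists_incl_eq {n : ℕ} {y : D.carrier} (hy : y ∈ L.piece n) : ∃ x, A.incl n x = y :=
  ⟨(A.equiv n).symm ⟨y, hy⟩, congrArg Subtype.val ((A.equiv n).apply_symm_apply ⟨y, hy⟩)⟩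

theorem d_incl_sub_mem (n : ℕ) (x : G.res.complex.X (n + 1)) :
    D.d (A.incl (n + 1) x) - A.incl n (G.diff n x) ∈ L.filtration n :=
  A.d_sub_mem n x

/-- The `n`-th piece is disjoint from the sum of the earlier ones. Together with
`exists_sub_incl_mem`, this gives elements of step `n + 1` a unique leading term in the resolution.
-/
theorem eq_zero_of_incl_mem {n : ℕ} {x : G.res.complex.X n} (h : A.incl n x ∈ L.filtration n) :
    x = 0 := by
  have h0 := Submodule.disjoint_def.1 (L.disjoint_piece_filtration n) _ (A.incl_mem_piece n x) h
  exact (A.equiv n).map_eq_zero_iff.1 (Subtype.ext h0)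

theorem exists_sub_incl_mem {n : ℕ} {y : D.carrier} (hy : y ∈ L.filtration (n + 1)) :
    ∃ x, y - A.incl n x ∈ L.filtration n := by
  rw [L.filtration_succ, Submodule.mem_sup] at hy
  obtain ⟨p, hp, q, hq, rfl⟩ := hy
  obtain ⟨x, rfl⟩ := A.exists_incl_eq hp
  exact ⟨x, by rwa [add_sub_cancel_left]⟩

theorem d_incl_zero (x : G.res.complex.X 0) : D.d (A.incl 0 x) = 0 :=
  L.d_eq_zero_of_mem_filtration_one (A.incl_mem_filtration Nat.zero_lt_one x)

theorem d_incl_one (x : G.res.complex.X 1) : D.d (A.incl 1 x) = A.incl 0 (G.diff 0 x) := by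
  have h := A.d_incl_sub_mem 0 x
  rwa [L.filtration_zero, Submodule.mem_bot, sub_eq_zero] at h

/-- Each piece is the image of a graded module under a homogeneous map, so projections preserve it;
induct on the leading term. -/
theorem proj_mem_filtration (A : G.Anchor L) (n : ℕ) (j : ℤ) (x : D.carrier)
    (hx : x ∈ L.filtration n) :
    proj D.isGraded.isInternal j x ∈ L.filtration n := by
  induction n generalizing x with
  | zero =>
    rw [L.filtration_zero, Submodule.mem_bot] at hx
    rw [hx, map_zero]
    exact zero_mem _
  | succ n ih =>
    obtain ⟨w, hw⟩ := A.exists_sub_incl_mem hx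
    have h := ih _ hw
    rw [map_sub] at h
    have h' : proj D.isGraded.isInternal j (A.incl n w) ∈ L.filtration (n + 1) := by
      have h1 := map_proj (G.isGraded n).isInternal D.isGraded.isInternal
        (A.incl n).toAddMonoidHom (-(n * a)) (A.incl_mem n) (j + n * a) w
      rw [add_neg_cancel_right] at h1
      exact h1 ▸ A.incl_mem_filtration n.lt_succ_self _
    simpa using add_mem (L.filtration_mono n.le_succ h) h'

/-- Every element with differential in the `n`-th step of the filtration is homologous to an
element of the step `n + 1`. -/
theorem exists_homologous (A : G.Anchor L) (n m : ℕ) (y : D.carrier) (hy : y ∈ L.filtration m)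
    (hdy : D.d y ∈ L.filtration n) :
    ∃ y' ∈ L.filtration (n + 1), y - y' ∈ LinearMap.range D.d := by
  induction m generalizing y with
  | zero => exact ⟨y, L.filtration_mono (Nat.zero_le _) hy, by rw [sub_self]; exact zero_mem _⟩
  | succ k ih =>
    obtain h | h := Nat.lt_or_ge n k
    · obtain ⟨k, rfl⟩ : ∃ k', k = k' + 1 := ⟨k - 1, by omega⟩
      obtain ⟨x, hx⟩ := A.exists_sub_incl_mem hy
      -- The leading term `x` of `y` is a cycle of `G`, because `d y` lies in step `k`. By exactness
      -- `x = ∂ w`, and subtracting the boundary `d (incl w)` lowers `y` by one step.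
      have h1 : A.incl k (G.diff k x) ∈ L.filtration k := by
        have e := sub_mem (sub_mem (L.filtration_mono (Nat.lt_succ_iff.1 h) hdy)
          (L.d_mem_filtration hx)) (A.d_incl_sub_mem k x)
        rwa [map_sub, sub_sub_cancel, sub_sub_cancel] at e
      obtain ⟨w, rfl⟩ := G.exists_diff_eq k x (A.eq_zero_of_incl_mem h1)
      obtain ⟨y', hy', hr⟩ := ih (y - D.d (A.incl (k + 1 + 1) w)) (by
        have e := sub_mem hx (A.d_incl_sub_mem (k + 1) w)
        rwa [sub_sub_sub_cancel_right] at e) (by rwa [map_sub, D.d_d, sub_zero])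
      refine ⟨y', hy', ?_⟩
      have e := add_mem hr ⟨A.incl (k + 1 + 1) w, rfl⟩
      rwa [sub_right_comm, sub_add_cancel] at e
    · exact ⟨y, L.filtration_mono (Nat.succ_le_succ h) hy, by rw [sub_self]; exact zero_mem _⟩

/-- Any primitive of `z` may be replaced by the homologous element of `exists_homologous`, which has
the same differential. -/
theorem exists_d_eq (A : G.Anchor L) (n : ℕ) (z : D.carrier) (hz : z ∈ L.filtration n)
    (hzr : z ∈ LinearMap.range D.d) : ∃ y ∈ L.filtration (n + 1), D.d y = z := by
  obtain ⟨y, rfl⟩ := hzr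
  obtain ⟨m, hm⟩ := L.exists_mem_filtration y
  obtain ⟨y', hy', w, hw⟩ := A.exists_homologous n m y hm hz
  refine ⟨y', hy', ?_⟩
  have h := congrArg D.d hw
  rw [D.d_d, map_sub] at h
  exact (sub_eq_zero.1 h.symm).symm

theorem exists_sub_incl_zero_mem_range (z : D.carrier) (hz : D.d z = 0) :
    ∃ x, z - A.incl 0 x ∈ LinearMap.range D.d := by
  obtain ⟨m, hm⟩ := L.exists_mem_filtration z
  obtain ⟨y, hy, hr⟩ := A.exists_homologous 0 m z hm (by rw [hz]; exact zero_mem _)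
  obtain ⟨x, hx⟩ := A.exists_sub_incl_mem hy
  rw [L.filtration_zero, Submodule.mem_bot, sub_eq_zero] at hx
  exact ⟨x, hx ▸ hr⟩

theorem incl_zero_mem_range_iff (x : G.res.complex.X 0) :
    A.incl 0 x ∈ LinearMap.range D.d ↔ G.aug x = 0 := by
  constructor
  · intro h
    -- A primitive exists in step `2`. Only its leading term `w` contributes to the differential, as
    -- `d` vanishes on step `1`; thus `x = ∂ w`.
    obtain ⟨y, hy, hyx⟩ := A.exists_d_eq 1 _ (A.incl_mem_filtration Nat.zero_lt_one x) h
    obtain ⟨w, hw⟩ := A.exists_sub_incl_mem hy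
    have h1 := L.d_eq_zero_of_mem_filtration_one hw
    rw [map_sub, hyx, A.d_incl_one, ← map_sub] at h1
    have h2 := A.eq_zero_of_incl_mem (h1 ▸ zero_mem _)
    rw [sub_eq_zero.1 h2, G.aug_diff]
  · intro h
    obtain ⟨w, rfl⟩ := G.exists_diff_eq_of_aug x h
    exact ⟨_, A.d_incl_one w⟩

/-- A map `⨁ n, X n → D` whose components agree with the inclusions modulo the filtration is
bijective. -/
theorem bijective_of_sub_incl_mem (φ : ∀ n, G.res.complex.X n →ₗ[S] D.carrier)
    (hφ : ∀ n x, φ n x - A.incl n x ∈ L.filtration n) :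
    Function.Bijective (DirectSum.toModule S ℕ D.carrier φ) := by
  classical
  have hmem : ∀ {i n} (_ : i < n) x, φ i x ∈ L.filtration n := fun {i n} h x => by
    have e := add_mem (L.filtration_mono h.le (hφ i x)) (A.incl_mem_filtration h x)
    rwa [sub_add_cancel] at e
  have hlof : ∀ i x, DirectSum.toModule S ℕ D.carrier φ
      (DirectSum.lof S ℕ (fun i => G.res.complex.X i) i x) =
      φ i x :=
    fun i x => DirectSum.toModule_lof (φ := φ) S i x
  constructor
  · rw [injective_iff_map_eq_zero]
    intro x hx
    obtain ⟨n, hn⟩ : ∃ n, ∀ i, n ≤ i → x i = 0 := by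
      refine ⟨(DFinsupp.support x).sup id + 1, fun i hi => ?_⟩
      by_contra h
      have := Finset.le_sup (f := id) (DFinsupp.mem_support_iff.2 h)
      simp only [id] at this
      omega
    induction n generalizing x with
    | zero =>
      ext i
      exact hn i (Nat.zero_le i)
    | succ n ih =>
      refine ih x hx fun i hi => ?_
      obtain rfl | h := hi.eq_or_lt
      swap
      · exact hn i h
      -- Removing the top component leaves an element mapped into step `n`. As `x` maps to `0`, so
      -- does `φ n (x n)` land in step `n`, and hence the inclusion of `x n`.
      let x' := x - DirectSum.lof S ℕ (fun i => G.res.complex.X i) n (x n)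
      have hx' : DirectSum.toModule S ℕ D.carrier φ x' ∈ L.filtration n := by
        rw [← DirectSum.sum_support_of x', map_sum]
        refine sum_mem fun i _ => ?_
        rw [← DirectSum.lof_eq_of S, hlof]
        obtain h | h := Nat.lt_or_ge i n
        · exact hmem h _
        · have h0 : x' i = 0 := by
            change x i - DirectSum.lof S ℕ (fun i => G.res.complex.X i) n (x n) i = 0
            obtain rfl | h := h.eq_or_lt
            · rw [DirectSum.lof_apply, sub_self]
            · rw [hn i h, DirectSum.lof_eq_of, DirectSum.of_eq_of_ne _ _ _ h.ne', sub_zero]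
          rw [h0, map_zero]
          exact zero_mem _
      refine A.eq_zero_of_incl_mem ?_
      rw [map_sub, hx, hlof, zero_sub, neg_mem_iff] at hx'
      have e := sub_mem hx' (hφ n (x n))
      rwa [sub_sub_cancel] at e
  · intro y
    obtain ⟨n, hn⟩ := L.exists_mem_filtration y
    induction n generalizing y with
    | zero =>
      rw [L.filtration_zero, Submodule.mem_bot] at hn
      exact ⟨0, by rw [hn, map_zero]⟩
    | succ n ih =>
      obtain ⟨x, hx⟩ := A.exists_sub_incl_mem hn
      obtain ⟨w, hw⟩ := ih (y - φ n x) (by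
        have e := sub_mem hx (hφ n x)
        rwa [sub_sub_sub_cancel_right] at e)
      exact ⟨w + DirectSum.lof S ℕ (fun i => G.res.complex.X i) n x,
        by rw [map_add, hw, hlof, sub_add_cancel]⟩

end FreeResolution.Anchor

/-- The inverse preserves degrees: if `f x` has degree `j`, then `x` and its degree `j` component
have the same image, so they coincide. -/
theorem DM.Hom.isomorphic_of_bijective {D E : DM 𝒮 a} (f : DM.Hom D E)
    (hf : Function.Bijective f.toLinearMap) : E.Isomorphic D := by
  refine ⟨(LinearEquiv.ofBijective f.toLinearMap hf).symm, fun j y => ?_, fun y => ?_⟩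
  · obtain ⟨x, rfl⟩ := hf.2 y
    have hx : (LinearEquiv.ofBijective f.toLinearMap hf).symm (f.toLinearMap x) = x :=
      (LinearEquiv.ofBijective f.toLinearMap hf).symm_apply_apply x
    rw [hx]
    refine ⟨fun h => ?_, f.map_mem j x⟩
    have h1 := map_proj D.isGraded.isInternal E.isGraded.isInternal f.toLinearMap.toAddMonoidHom 0
      (fun j x hx => by simpa using f.map_mem j x hx) j x
    rw [add_zero] at h1
    have h2 := hf.1 (h1.trans (proj_of_mem E.isGraded.isInternal h))
    rw [← h2]
    exact proj_mem _ _ _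
  · rw [LinearEquiv.eq_symm_apply]
    change f.toLinearMap (D.d _) = _
    rw [← f.comm]
    congr 1
    exact (LinearEquiv.ofBijective f.toLinearMap hf).apply_symm_apply y

/-- The inclusions commute with the differentials up to earlier pieces, so they serve as the
approximate map `Φ`, with the filtration as `N`. The corrected map is triangular, hence an
isomorphism. -/
theorem FreeResolution.isRigid [GradedRing 𝒮] (hM : IsGradedModule 𝒮 ℳ) (G : FreeResolution 𝒮 ℳ)
    (hcob : ∀ (n : ℕ) (f : G.res.complex.X (n + 2) →ₗ[S] M), (∀ x, f (G.diff (n + 2) x) = 0) →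
      (∀ m x, x ∈ G.grading (n + 2) m → f x ∈ ℳ (m + -((n + 1 : ℕ) * a))) →
      ∃ g : G.res.complex.X (n + 1) →ₗ[S] M,
        (∀ m x, x ∈ G.grading (n + 1) m → g x ∈ ℳ (m + -((n + 1 : ℕ) * a))) ∧
          ∀ x, g (G.diff (n + 1) x) = f x) :
    G.toComplex.IsRigid a := by
  rintro D L ⟨e, he, hd⟩
  let A : G.Anchor L := ⟨e, he, hd⟩
  obtain ⟨φ, hφ, hφL, hdφ, hφ0⟩ := G.exists_fold_map hM D hcob L.filtration A.proj_mem_filtration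
    A.exists_d_eq A.incl A.incl_mem A.d_incl_sub_mem (A.incl 0)
    (fun m x hx => by simpa using A.incl_mem 0 m x hx) A.d_incl_zero
    (fun n x => A.incl_mem_filtration n.succ_pos x)
    (fun x => by rw [sub_self]; exact zero_mem _) A.exists_sub_incl_zero_mem_range
    A.incl_zero_mem_range_iff
  exact (G.toComplex.foldDesc D φ hφ (fun x => by rw [hφ0]; exact A.d_incl_zero x)
    hdφ).isomorphic_of_bijective (A.bijective_of_sub_incl_mem φ hφL)

end Flags

end DiffMod

theorem mainTheorem4 {S : Type u} [CommRing S] [IsNoetherianRing S]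
    (𝒮 : ℕ → AddSubgroup S) [GradedRing 𝒮] [IsLocalRing (𝒮 0)]
    [IsAlgClosed (IsLocalRing.ResidueField (𝒮 0))]
    {M : Type u} [AddCommGroup M] [Module S M] [Module.Finite S M]
    (ℳ : ℤ → AddSubgroup M) (hM : DiffMod.IsGradedModule 𝒮 ℳ)
    (F : DiffMod.FreeResolution 𝒮 ℳ) (hF : F.IsMinimal) (a : ℤ)
    (hExt : ∀ i : ℕ, 2 ≤ i →
      (i : WithBot ℕ∞) ≤ CategoryTheory.projectiveDimension (ModuleCat.of S M) →
      F.extDegree ℳ i (a - i * a) = ⊥) :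
    (∀ D : DiffMod.DM 𝒮 a, D.HasHomology ℳ → D.QuasiIsomorphic (F.toComplex.fold a)) ∧
      DiffMod.IsRigidModule 𝒮 ℳ a := by
  -- This is the group containing the obstruction to choosing `φ (n + 1)`. Beyond the projective
  -- dimension it vanishes automatically.
  have hvanish : ∀ n : ℕ, F.extDegree ℳ (n + 2) (-((n + 1 : ℕ) * a)) = ⊥ := by
    intro n
    obtain h | h := le_or_gt ((n + 2 : ℕ) : WithBot ℕ∞) (projectiveDimension (ModuleCat.of S M))
    · have e : -(((n + 1 : ℕ) : ℤ) * a) = a - (n + 2 : ℕ) * a := by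
        push_cast
        ring
      rw [e]
      exact hExt (n + 2) (by omega) h
    · exact F.extDegree_eq_bot_of_projectiveDimension_lt ℳ _ _ h
  have hcob := fun (G : DiffMod.FreeResolution 𝒮 ℳ) (n : ℕ) =>
    DiffMod.FreeResolution.exists_homogeneous_coboundary hM hM F G (n + 1) _ (hvanish n)
  exact ⟨fun D hD => F.quasiIsomorphic_fold hM D hD (hcob F), fun G => G.isRigid hM (hcob G)⟩
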